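/- For each integer $k\ge 1$ let $f_k=\prod_{m=1}^{\infty}(1-q^{km})$, a formal power series in $q$. Let $a_9(n)$ denote the number of 9-regular cubic partitions of $n$, that is, the integers defined by the generating function \[\sum_{n\ge 0}a_9(n)q^n=\frac{f_9f_{18}}{f_1f_2}.\] Then for all integers $\alpha\ge 0$ and $n\ge 0$, \[a_9\left(3^{\alpha+1}n+3^{\alpha+1}-1\right)\equiv 0 \pmod{3^{\alpha+1}}.\] -/

import Mathlib

namespace CubicPartition

open PowerSeries
open scoped PowerSeries.WithPiTopology

/-- The Euler product `f_k = ∏_{m ≥ 1} (1 - q^{k m})`, as a formal power series in `q = X` with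
integer coefficients. The infinite product converges coefficientwise (the topology on `ℤ⟦X⟧` is
the product topology over the discrete topology of `ℤ`). -/
noncomputable def f (k : ℕ) : PowerSeries ℤ :=
  ∏' m : ℕ, (1 - (X : PowerSeries ℤ) ^ (k * (m + 1)))

/-- The infinite product defining `f k` converges for `k ≥ 1`. -/
theorem multipliable_f {k : ℕ} (hk : 1 ≤ k) :
    Multipliable fun m : ℕ => 1 - (X : PowerSeries ℤ) ^ (k * (m + 1)) := by
  simp_rw [sub_eq_add_neg]
  apply WithPiTopology.multipliable_one_add_of_tendsto_order_atTop_nhds_top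
  refine ENat.tendsto_nhds_top_iff_natCast_lt.mpr
    (fun n => Filter.eventually_atTop.mpr ⟨n, fun m hm => ?_⟩)
  rw [order_neg, order_X_pow, Nat.cast_lt]
  nlinarith

theorem constantCoeff_f {k : ℕ} (hk : 1 ≤ k) : constantCoeff (f k) = 1 := by
  have hk0 : k ≠ 0 := by omega
  rw [f, (multipliable_f hk).map_tprod _ (WithPiTopology.continuous_constantCoeff ℤ)]
  simp [hk0]

/-- The generating function `f_9 f_18 / (f_1 f_2)` of the 9-regular cubic partitions; the
denominator has constant term `1`, so it is invertible in `ℤ⟦X⟧`. -/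
noncomputable def genFun9 : PowerSeries ℤ :=
  f 9 * f 18 * invOfUnit (f 1 * f 2) 1

/-- `genFun9` is the quotient of `f_9 f_18` by `f_1 f_2`. -/
theorem genFun9_mul : genFun9 * (f 1 * f 2) = f 9 * f 18 := by
  rw [genFun9, mul_assoc, mul_comm (invOfUnit _ _), mul_invOfUnit, mul_one]
  simp [constantCoeff_f]

/-- `a₉(n)`, the number of 9-regular cubic partitions of `n`: the coefficient of `q^n` in
`f_9 f_18 / (f_1 f_2)`. -/
noncomputable def a9 (n : ℕ) : ℤ := coeff n genFun9

end CubicPartition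

/-! Write e = f₁f₂, H = f₃f₆, G = f₉f₁₈, F = qG/e and t = qH⁴/e⁴, and let U = `sift` keep the
exponents divisible by 3. The value of `a9` in question is the coefficient of q^(3^(α+1)(n+1)) in F,
so it suffices that 3^(α+1) divides U^(α+1)F.

Here UF = 3t, and U maps 3t·ℤ[3t] into 3·3t·ℤ[3t] (`exists_sift_mul_aeval`), so each further
application gains a factor 3. The second fact holds because 3t = 3F + (3F)² + (3F)³ is a polynomial
in 3F without constant term, while F³ = t(q³)(1 + 3F + 9F²) turns the U((3F)^k) into a recurrence
started by UF and UF² = 2t + 27t².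

These identities (`modular_equation`) follow from the 3-dissection of e (`exists_dissection`) and
from `cubic_relation`, the product of that dissection over q ↦ ωⁱq with ω³ = 1. The dissection comes
from e = φ(-q)ψ(q), with φ(-q) = f₁²/f₂ and ψ(q) = f₂²/f₁ written as theta series by the Jacobi
triple product. -/

namespace CubicPartition

open PowerSeries
open scoped PowerSeries.WithPiTopology

/-! ### Triangular numbers of integers. -/

section Triangular

/-- The triangular number `j (j + 1) / 2` of an integer. -/
def tri (j : ℤ) : ℕ := (j * (j + 1) / 2).toNat

theorem two_mul_tri (j : ℤ) : 2 * (tri j : ℤ) = j * (j + 1) := by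
  have h : 0 ≤ j * (j + 1) := by
    rcases le_or_gt 0 j with h | h
    · positivity
    · nlinarith
  have h2 : 2 ∣ j * (j + 1) := (Int.even_mul_succ_self j).two_dvd
  rw [tri, Int.toNat_of_nonneg (by positivity), Int.mul_ediv_cancel' h2]

theorem tri_add_one (j : ℤ) : (tri (j + 1) : ℤ) = tri j + j + 1 := by
  linarith [two_mul_tri j, two_mul_tri (j + 1)]

theorem tri_neg (j : ℤ) : (tri (-j) : ℤ) = tri j - j := by
  linarith [two_mul_tri j, two_mul_tri (-j)]

/-- The right side equals j². The bound gives summability of theta series. -/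
theorem natAbs_le_tri_add_tri_neg (j : ℤ) : j.natAbs ≤ tri j + tri (-j) := by
  zify
  rw [tri_neg]
  have := two_mul_tri j
  rcases abs_cases j with ⟨h, h'⟩ | ⟨h, h'⟩ <;> rw [h] <;> nlinarith

end Triangular

/-! ### Terms of a two-variable theta series. -/

section ThetaTerm

/-- The general term `x ^ (j (j + 1) / 2) * y ^ (j (j - 1) / 2)` of Ramanujan's theta series. -/
noncomputable def thetaTerm (x y : ℤ⟦X⟧) (j : ℤ) : ℤ⟦X⟧ := x ^ tri j * y ^ tri (-j)

theorem thetaTerm_neg (x y : ℤ⟦X⟧) (j : ℤ) : thetaTerm x y (-j) = thetaTerm y x j := by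
  simp [thetaTerm, mul_comm]

theorem thetaTerm_mul_left (x y : ℤ⟦X⟧) {j : ℤ} {m k : ℕ} (h : (k : ℤ) = m - j) :
    thetaTerm x y j * (x * (x * y) ^ m) = (x * y) ^ k * thetaTerm x y (j + 1) := by
  have h1 : tri j + 1 + m = k + tri (j + 1) := by
    have := tri_add_one j
    lia
  have h2 : tri (-j) + m = k + tri (-(j + 1)) := by
    have := tri_add_one j
    have := tri_neg j
    have := tri_neg (j + 1)
    lia
  calc _ = x ^ (tri j + 1 + m) * y ^ (tri (-j) + m) := by rw [thetaTerm]; ring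
    _ = _ := by rw [h1, h2, thetaTerm]; ring

theorem thetaTerm_mul_right (x y : ℤ⟦X⟧) {j : ℤ} {m k : ℕ} (h : (k : ℤ) = m + j) :
    thetaTerm x y j * (y * (x * y) ^ m) = (x * y) ^ k * thetaTerm x y (j - 1) := by
  have := thetaTerm_mul_left y x (j := -j) (m := m) (k := k) (by lia)
  rw [thetaTerm_neg, show -j + 1 = -(j - 1) by ring, thetaTerm_neg, mul_comm y x] at this
  exact this

theorem X_pow_dvd_thetaTerm {x y : ℤ⟦X⟧} (hx : X ∣ x) (hy : X ∣ y) (j : ℤ) :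
    X ^ j.natAbs ∣ thetaTerm x y j :=
  (pow_dvd_pow X (natAbs_le_tri_add_tri_neg j)).trans <| by
    rw [pow_add]
    exact mul_dvd_mul (pow_dvd_pow_of_dvd hx _) (pow_dvd_pow_of_dvd hy _)

theorem coeff_eq_zero_of_X_pow_dvd {R : Type*} [CommRing R] {g : R⟦X⟧} {m d : ℕ}
    (h : X ^ m ∣ g) (hd : d < m) :
    coeff d g = 0 :=
  X_pow_dvd_iff.mp h d hd

theorem summable_thetaTerm {x y : ℤ⟦X⟧} (hx : X ∣ x) (hy : X ∣ y) :
    Summable (thetaTerm x y) := by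
  rw [WithPiTopology.summable_iff_summable_coeff]
  intro d
  refine summable_of_hasFiniteSupport ((Set.finite_Icc (-(d : ℤ)) d).subset fun j hj => ?_)
  by_contra hc
  refine hj (coeff_eq_zero_of_X_pow_dvd (X_pow_dvd_thetaTerm hx hy j) ?_)
  rw [Set.mem_Icc] at hc
  lia

end ThetaTerm

/-! ### Finite q-factorials and their reciprocals. -/

section QPochhammer

/-- The finite product `(1 - Q) (1 - Q ^ 2) ⋯ (1 - Q ^ n)`. -/
noncomputable def qPoch (Q : ℤ⟦X⟧) (n : ℕ) : ℤ⟦X⟧ := ∏ i ∈ Finset.range n, (1 - Q ^ (i + 1))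

theorem qPoch_succ (Q : ℤ⟦X⟧) (n : ℕ) : qPoch Q (n + 1) = qPoch Q n * (1 - Q ^ (n + 1)) :=
  Finset.prod_range_succ _ _

theorem constantCoeff_qPoch {Q : ℤ⟦X⟧} (hQ : X ∣ Q) (n : ℕ) : constantCoeff (qPoch Q n) = 1 := by
  simp [qPoch, X_dvd_iff.mp hQ]

/-- The reciprocal of `qPoch`, extended by zero to negative integers. -/
noncomputable def qPochInv (Q : ℤ⟦X⟧) : ℤ → ℤ⟦X⟧
  | .ofNat n => invOfUnit (qPoch Q n) 1
  | .negSucc _ => 0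

theorem qPochInv_of_neg (Q : ℤ⟦X⟧) {k : ℤ} (hk : k < 0) : qPochInv Q k = 0 := by
  cases k with
  | ofNat n => simp at hk; lia
  | negSucc n => rfl

theorem qPoch_mul_qPochInv {Q : ℤ⟦X⟧} (hQ : X ∣ Q) (n : ℕ) : qPoch Q n * qPochInv Q n = 1 :=
  mul_invOfUnit _ _ (by simp [constantCoeff_qPoch hQ])

theorem qPochInv_sub_one {Q : ℤ⟦X⟧} (hQ : X ∣ Q) (n : ℕ) :
    qPochInv Q ((n : ℤ) - 1) = (1 - Q ^ n) * qPochInv Q n := by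
  cases n with
  | zero => simp [qPochInv_of_neg]
  | succ n =>
    have h1 := qPoch_mul_qPochInv hQ n
    have h2 := qPoch_mul_qPochInv hQ (n + 1)
    rw [qPoch_succ] at h2
    rw [show ((n + 1 : ℕ) : ℤ) - 1 = n by simp]
    linear_combination (1 - Q ^ (n + 1)) * qPochInv Q (n + 1 : ℕ) * h1 - qPochInv Q n * h2

theorem X_pow_dvd_qPoch_add_sub {Q : ℤ⟦X⟧} (hQ : X ∣ Q) (d k : ℕ) :
    X ^ (d + 1) ∣ qPoch Q (d + k) - qPoch Q d := by
  induction k with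
  | zero => simp
  | succ k ih =>
    rw [← add_assoc, qPoch_succ]
    have : X ^ (d + 1) ∣ Q ^ (d + k + 1) :=
      (pow_dvd_pow_of_dvd hQ _).trans (pow_dvd_pow _ (by lia))
    convert! dvd_sub ih (this.mul_left (qPoch Q (d + k))) using 1
    ring

theorem X_pow_dvd_qPoch_sub {Q : ℤ⟦X⟧} (hQ : X ∣ Q) {d k l : ℕ} (hk : d ≤ k) (hl : d ≤ l) :
    X ^ (d + 1) ∣ qPoch Q k - qPoch Q l := by
  obtain ⟨k, rfl⟩ := Nat.exists_eq_add_of_le hk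
  obtain ⟨l, rfl⟩ := Nat.exists_eq_add_of_le hl
  simpa using dvd_sub (X_pow_dvd_qPoch_add_sub hQ d k) (X_pow_dvd_qPoch_add_sub hQ d l)

end QPochhammer

/-! ### The Jacobi triple product, from its finite form. -/

section TripleProduct

open Filter Topology

/-- The coefficients of the finite form of the Jacobi triple product: the Gaussian binomial
coefficients `[2 n, n + j]`. -/
noncomputable def gaussCoeff (Q : ℤ⟦X⟧) (n : ℕ) (j : ℤ) : ℤ⟦X⟧ :=
  qPoch Q (2 * n) * (qPochInv Q (n - j) * qPochInv Q (n + j))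

/-- The q-Pascal rule applied twice. It matches multiplication of the finite product by its next two
factors. -/
theorem gaussCoeff_succ {Q : ℤ⟦X⟧} (hQ : X ∣ Q) {n k l : ℕ} {j : ℤ}
    (hk : (k : ℤ) = n + 1 - j) (hl : (l : ℤ) = n + 1 + j) :
    gaussCoeff Q (n + 1) j = gaussCoeff Q n j * (1 + Q ^ (2 * n + 1)) +
      gaussCoeff Q n (j - 1) * Q ^ k + gaussCoeff Q n (j + 1) * Q ^ l := by
  have hkl : k + l = 2 * n + 2 := by lia
  -- The truncated exponent `m - 1` is harmless: at `m = 0` the factor 1 - Q⁰ vanishes, as does the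
  -- left side. The same happens in `shift`.
  have two_sub (m : ℕ) : qPochInv Q ((m : ℤ) - 2) =
      (1 - Q ^ (m - 1)) * (1 - Q ^ m) * qPochInv Q m := by
    cases m with
    | zero => simp [qPochInv_of_neg]
    | succ m =>
      have h1 := qPochInv_sub_one hQ m
      have h2 := qPochInv_sub_one hQ (m + 1)
      rw [show ((m + 1 : ℕ) : ℤ) - 1 = m by simp] at h2
      rw [show ((m + 1 : ℕ) : ℤ) - 2 = m - 1 by push_cast; ring, h1, h2]
      simp [mul_assoc]
  have shift (a b : ℕ) (h : a + b = 2 * n + 2) :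
      Q ^ a * ((1 - Q ^ (b - 1)) * (1 - Q ^ b)) = (Q ^ a - Q ^ (2 * n + 1)) * (1 - Q ^ b) := by
    cases b with
    | zero => simp
    | succ b =>
      rw [show 2 * n + 1 = a + b by lia]
      simp only [Nat.add_sub_cancel]
      ring
  have e1 : (n : ℤ) - j = k - 1 := by lia
  have e2 : (n : ℤ) + j = l - 1 := by lia
  have e3 : (n : ℤ) - (j - 1) = k := by lia
  have e4 : (n : ℤ) + (j - 1) = l - 2 := by lia
  have e5 : (n : ℤ) - (j + 1) = k - 2 := by lia
  have e6 : (n : ℤ) + (j + 1) = l := by lia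
  have e7 : ((n + 1 : ℕ) : ℤ) - j = k := by push_cast; lia
  have e8 : ((n + 1 : ℕ) : ℤ) + j = l := by push_cast; lia
  have hs : Q ^ (2 * n + 1) * Q = Q ^ k * Q ^ l := by
    rw [← pow_succ, ← pow_add, hkl]
  have hs' : Q ^ (2 * n + 1 + 1) = Q ^ k * Q ^ l := by rw [← pow_add, hkl]
  rw [gaussCoeff, gaussCoeff, gaussCoeff, gaussCoeff, e1, e2, e3, e4, e5, e6, e7, e8,
    two_sub, two_sub, qPochInv_sub_one hQ, qPochInv_sub_one hQ,
    show 2 * (n + 1) = 2 * n + 1 + 1 by ring, qPoch_succ, qPoch_succ, hs']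
  linear_combination
    (-qPoch Q (2 * n) * qPochInv Q k * qPochInv Q l) * (shift k l hkl + shift l k (by lia))

theorem gaussCoeff_eq_zero (Q : ℤ⟦X⟧) {n : ℕ} {j : ℤ} (h : (n : ℤ) < |j|) :
    gaussCoeff Q n j = 0 := by
  rcases lt_abs.mp h with h | h
  · rw [gaussCoeff, qPochInv_of_neg Q (by lia : (n : ℤ) - j < 0)]; simp
  · rw [gaussCoeff, qPochInv_of_neg Q (by lia : (n : ℤ) + j < 0)]; simp

/-- The finite form of the Jacobi triple product. -/
theorem hasSum_gaussCoeff_mul_thetaTerm {x y : ℤ⟦X⟧} (hQ : X ∣ x * y) (n : ℕ) :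
    HasSum (fun j => gaussCoeff (x * y) n j * thetaTerm x y j)
      (∏ i ∈ Finset.range n, ((1 + x * (x * y) ^ i) * (1 + y * (x * y) ^ i))) := by
  induction n with
  | zero =>
    have h0 := qPoch_mul_qPochInv hQ 0
    simp only [qPoch, Finset.range_zero, Finset.prod_empty, Nat.cast_zero, one_mul] at h0
    have h : HasSum (fun j => gaussCoeff (x * y) 0 j * thetaTerm x y j) _ :=
      hasSum_single 0 fun j hj => by rw [gaussCoeff_eq_zero _ (by simpa using hj), zero_mul]
    have h1 : gaussCoeff (x * y) 0 0 * thetaTerm x y 0 = 1 := by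
      simp [gaussCoeff, h0, qPoch, thetaTerm, tri]
    rw [h1] at h
    simpa using h
  | succ n ih =>
    have h0 := ih.mul_right (1 + (x * y) ^ (2 * n + 1))
    have h1 := (Equiv.subRight (1 : ℤ)).hasSum_iff.mpr (ih.mul_right (x * (x * y) ^ n))
    have h2 := (Equiv.addRight (1 : ℤ)).hasSum_iff.mpr (ih.mul_right (y * (x * y) ^ n))
    rw [Finset.prod_range_succ]
    convert! (h0.add h1).add h2 using 1
    · funext j
      simp only [Function.comp_apply, Equiv.coe_addRight, Equiv.subRight_apply]
      by_cases hj : |j| ≤ n + 1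
      · obtain ⟨k, hk⟩ := Int.eq_ofNat_of_zero_le (by have := abs_le.mp hj; lia : 0 ≤ n + 1 - j)
        obtain ⟨l, hl⟩ := Int.eq_ofNat_of_zero_le (by have := abs_le.mp hj; lia : 0 ≤ n + 1 + j)
        have e1 := thetaTerm_mul_left x y (j := j - 1) (m := n) (k := k) (by lia)
        have e2 := thetaTerm_mul_right x y (j := j + 1) (m := n) (k := l) (by lia)
        rw [sub_add_cancel] at e1
        rw [add_sub_cancel_right] at e2
        rw [gaussCoeff_succ hQ hk.symm hl.symm, mul_assoc (gaussCoeff _ n (j - 1)), e1,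
          mul_assoc (gaussCoeff _ n (j + 1)), e2]
        ring
      · rw [not_le] at hj
        have := lt_abs.mp hj
        rw [gaussCoeff_eq_zero _ (by push_cast; exact hj),
          gaussCoeff_eq_zero _ (by lia : (n : ℤ) < |j|),
          gaussCoeff_eq_zero _ (lt_abs.mpr (by lia) : (n : ℤ) < |j - 1|),
          gaussCoeff_eq_zero _ (lt_abs.mpr (by lia) : (n : ℤ) < |j + 1|)]
        ring
    · ring

/-- The expression is (Q)ₙ(Q)₂ₙ / ((Q)ₙ₋ⱼ(Q)ₙ₊ⱼ) - 1, and all four indices are at least d, so the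
four factors agree modulo X^(d+1). -/
theorem X_pow_dvd_qPoch_mul_gaussCoeff_sub_one {Q : ℤ⟦X⟧} (hQ : X ∣ Q) {n d : ℕ} {j : ℤ}
    (hj : j.natAbs ≤ d) (hn : 2 * d ≤ n) : X ^ (d + 1) ∣ qPoch Q n * gaussCoeff Q n j - 1 := by
  obtain ⟨k, hk⟩ := Int.eq_ofNat_of_zero_le (by lia : 0 ≤ n - j)
  obtain ⟨l, hl⟩ := Int.eq_ofNat_of_zero_le (by lia : 0 ≤ n + j)
  obtain ⟨u, hu⟩ := X_pow_dvd_qPoch_sub hQ (by lia : d ≤ n) (by lia : d ≤ k)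
  obtain ⟨v, hv⟩ := X_pow_dvd_qPoch_sub hQ (by lia : d ≤ 2 * n) (by lia : d ≤ l)
  have h1 := qPoch_mul_qPochInv hQ k
  have h2 := qPoch_mul_qPochInv hQ l
  rw [gaussCoeff, hk, hl]
  refine ⟨qPochInv Q k * qPochInv Q l * (u * qPoch Q (2 * n) + v * qPoch Q k), ?_⟩
  linear_combination qPochInv Q k * qPochInv Q l * (qPoch Q (2 * n) * hu + qPoch Q k * hv) +
    qPochInv Q l * qPoch Q l * h1 + h2

theorem tendsto_tripleProduct {x y : ℤ⟦X⟧} (hx : X ∣ x) (hy : X ∣ y) :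
    Tendsto (fun n => qPoch (x * y) n *
      ∏ i ∈ Finset.range n, ((1 + x * (x * y) ^ i) * (1 + y * (x * y) ^ i))) atTop
      (𝓝 (∑' j, thetaTerm x y j)) := by
  rw [WithPiTopology.tendsto_iff_coeff_tendsto]
  intro d
  refine tendsto_const_nhds.congr' ((eventually_ge_atTop (2 * d)).mono fun n hn => ?_)
  have hQ : X ∣ x * y := hx.mul_right y
  have h := ((hasSum_gaussCoeff_mul_thetaTerm hQ n).mul_left (qPoch (x * y) n)).sub
    (summable_thetaTerm hx hy).hasSum
  have h' := h.map (coeff d) (WithPiTopology.continuous_coeff ℤ d)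
  -- Terms with |j| ≤ d agree by the Gaussian estimate; the others have order above d on both sides.
  have hz : (⇑(coeff d) ∘ fun j => qPoch (x * y) n * (gaussCoeff (x * y) n j * thetaTerm x y j) -
      thetaTerm x y j) = fun _ => (0 : ℤ) := by
    funext j
    rw [Function.comp_apply, ← mul_assoc, ← sub_one_mul]
    rcases le_or_gt j.natAbs d with hj | hj
    · exact coeff_eq_zero_of_X_pow_dvd
        ((X_pow_dvd_qPoch_mul_gaussCoeff_sub_one hQ hj hn).mul_right _) (Nat.lt_succ_self d)
    · exact coeff_eq_zero_of_X_pow_dvd ((X_pow_dvd_thetaTerm hx hy j).mul_left _) hj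
  rw [hz] at h'
  have := h'.unique hasSum_zero
  rw [map_sub] at this
  lia

end TripleProduct

/-! ### Infinite products over arithmetic progressions. -/

section InfiniteProducts

open Filter Topology

theorem multipliable_one_add_of_X_pow_dvd {R : Type*} [CommRing R] [TopologicalSpace R]
    {s : ℕ → R⟦X⟧} (h : ∀ i, X ^ i ∣ s i) : Multipliable fun i => 1 + s i := by
  apply WithPiTopology.multipliable_one_add_of_tendsto_order_atTop_nhds_top
  refine ENat.tendsto_nhds_top_iff_natCast_lt.mpr fun n => eventually_atTop.mpr ⟨n + 1, fun m hm => ?_⟩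
  exact lt_of_lt_of_le (Nat.cast_lt.mpr hm) (nat_le_order _ _ (X_pow_dvd_iff.mp (h m)))

theorem X_pow_dvd_C_mul_X_pow {R : Type*} [CommRing R] (c : R) {a : ℕ} (ha : 0 < a) (b i : ℕ) :
    (X : R⟦X⟧) ^ i ∣ C c * X ^ (a * i + b) :=
  (pow_dvd_pow X (by nlinarith)).mul_left _

variable {R : Type*} [CommRing R] [TopologicalSpace R]

/-- The infinite product `∏_{i ≥ 0} (1 + c q ^ (a i + b))`. -/
noncomputable def linProd (c : R) (a b : ℕ) : R⟦X⟧ := ∏' i : ℕ, (1 + C c * X ^ (a * i + b))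

theorem multipliable_linProd (c : R) {a : ℕ} (ha : 0 < a) (b : ℕ) :
    Multipliable fun i : ℕ => 1 + C c * X ^ (a * i + b) :=
  multipliable_one_add_of_X_pow_dvd (X_pow_dvd_C_mul_X_pow c ha b)

theorem f_eq_linProd (k : ℕ) : f k = linProd (-1) k k := by
  refine tprod_congr fun i => ?_
  rw [map_neg, map_one, mul_add, mul_one]
  ring

theorem continuous_expand {p : ℕ} (hp : p ≠ 0) :
    Continuous (expand p hp : R⟦X⟧ →ₐ[R] R⟦X⟧) := by
  refine continuous_iff_continuousAt.mpr fun g => ?_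
  rw [ContinuousAt, WithPiTopology.tendsto_iff_coeff_tendsto]
  intro d
  simp_rw [coeff_expand]
  split_ifs
  · exact (WithPiTopology.continuous_coeff R (d / p)).continuousAt
  · exact tendsto_const_nhds

theorem continuous_rescale_map (φ : ℤ →+* R) (z : R) :
    Continuous ((rescale z).comp (map φ) : ℤ⟦X⟧ →+* R⟦X⟧) := by
  refine continuous_iff_continuousAt.mpr fun g => ?_
  rw [ContinuousAt, WithPiTopology.tendsto_iff_coeff_tendsto]
  intro d
  simp only [RingHom.comp_apply, coeff_rescale, coeff_map]
  exact ((continuous_of_discreteTopology (f := fun n : ℤ => z ^ d * φ n)).comp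
    (WithPiTopology.continuous_coeff ℤ d)).continuousAt

variable [DiscreteTopology R]

/-- Sort the factors by the residue of i modulo m. This brings products with different moduli to a
common one. -/
theorem linProd_eq_prod (c : R) {a : ℕ} (ha : 0 < a) (b : ℕ) {m : ℕ} (hm : 0 < m) :
    linProd c a b = ∏ r ∈ Finset.range m, linProd c (m * a) (a * r + b) := by
  have h1 := (multipliable_linProd c ha b).hasProd.tendsto_prod_nat.comp
    (tendsto_id.const_mul_atTop' hm)
  have h2 := tendsto_finsetProd (Finset.range m) fun r _ =>
    (multipliable_linProd c (Nat.mul_pos hm ha) (a * r + b)).hasProd.tendsto_prod_nat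
  refine tendsto_nhds_unique h1 (h2.congr fun n => ?_)
  simp only [Function.comp_apply, id]
  rw [Finset.prod_comm]
  induction n with
  | zero => simp
  | succ n ih =>
    rw [Finset.prod_range_succ, ih, mul_add, mul_one, Finset.prod_range_add]
    congr 1
    refine Finset.prod_congr rfl fun r _ => ?_
    ring

theorem linProd_mul_linProd_neg (c : R) {a : ℕ} (ha : 0 < a) (b : ℕ) :
    linProd c a b * linProd (-c) a b = linProd (-c ^ 2) (2 * a) (2 * b) := by
  rw [linProd, linProd, ← (multipliable_linProd c ha b).tprod_mul (multipliable_linProd (-c) ha b)]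
  refine tprod_congr fun i => ?_
  rw [mul_assoc 2 a i, ← mul_add, pow_mul', map_neg, map_neg, map_pow]
  ring

/-- Factorwise, (1 - y)(1 - ωy)(1 - ω²y) = 1 - y³. -/
theorem linProd_mul_linProd_mul_linProd {ω : R} (hω : ω ^ 2 + ω + 1 = 0) {a : ℕ} (ha : 0 < a)
    (b : ℕ) :
    linProd (-1) a b * linProd (-ω) a b * linProd (-ω ^ 2) a b = linProd (-1) (3 * a) (3 * b) := by
  have hω' : (C ω) ^ 2 + C ω + 1 = (0 : R⟦X⟧) := by
    rw [← map_pow, ← map_add, ← map_one C, ← map_add, hω, map_zero]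
  rw [linProd, linProd, linProd, ← (multipliable_linProd (-1) ha b).tprod_mul
    (multipliable_linProd (-ω) ha b), ← ((multipliable_linProd (-1) ha b).mul
    (multipliable_linProd (-ω) ha b)).tprod_mul (multipliable_linProd (-ω ^ 2) ha b)]
  refine tprod_congr fun i => ?_
  rw [mul_assoc 3 a i, ← mul_add, pow_mul', map_neg, map_neg, map_neg, map_pow, map_one]
  generalize (X : R⟦X⟧) ^ (a * i + b) = y
  linear_combination (-y + C ω * y ^ 2 - (C ω - 1) * y ^ 3) * hω'

theorem linProd_ne_zero [Nontrivial R] (c : R) {a b : ℕ} (ha : 0 < a) (hb : 0 < b) :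
    linProd c a b ≠ 0 := by
  intro h
  have := congrArg constantCoeff h
  rw [linProd, (multipliable_linProd c ha b).map_tprod _ (WithPiTopology.continuous_constantCoeff R)]
    at this
  simp [hb.ne'] at this

theorem expand_linProd (c : R) {a : ℕ} (ha : 0 < a) (b : ℕ) {p : ℕ} (hp : p ≠ 0) :
    expand p hp (linProd c a b) = linProd c (p * a) (p * b) := by
  rw [linProd, (multipliable_linProd c ha b).map_tprod _ (continuous_expand hp)]
  refine tprod_congr fun i => ?_
  rw [map_add, map_mul, map_pow, expand_C, expand_X, map_one, ← pow_mul]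
  ring

theorem rescale_map_linProd (φ : ℤ →+* R) {z : R} (c : ℤ) {a : ℕ} (ha : 0 < a) (hz : z ^ a = 1)
    (b : ℕ) : rescale z (map φ (linProd c a b)) = linProd (φ c * z ^ b) a b := by
  rw [← RingHom.comp_apply, linProd,
    (multipliable_linProd c ha b).map_tprod _ (continuous_rescale_map φ z)]
  refine tprod_congr fun i => ?_
  simp only [RingHom.comp_apply, map_add, map_mul, map_pow, map_C, map_X, map_one, rescale_X]
  have hC : rescale z (C (φ c)) = C (φ c) := by
    ext n
    rw [coeff_rescale, coeff_C]
    split_ifs with h <;> simp [h]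
  rw [hC, mul_pow, ← map_pow, pow_add z, pow_mul, hz, one_pow, one_mul, mul_assoc, map_pow]

end InfiniteProducts

/-! ### Euler products under q ↦ q^p. -/

section EulerProducts

theorem f_ne_zero {k : ℕ} (hk : 0 < k) : f k ≠ 0 := f_eq_linProd k ▸ linProd_ne_zero _ hk hk

theorem expand_f {k p : ℕ} (hk : 0 < k) (hp : p ≠ 0) : expand p hp (f k) = f (p * k) := by
  rw [f_eq_linProd, f_eq_linProd, expand_linProd _ hk]

end EulerProducts

/-! ### Theta series: product formula and dissections. -/

section Theta

open Filter Topology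

/-- Ramanujan's theta series `∑_j x ^ (j (j + 1) / 2) * y ^ (j (j - 1) / 2)`. -/
noncomputable def theta (x y : ℤ⟦X⟧) : ℤ⟦X⟧ := ∑' j, thetaTerm x y j

theorem theta_comm (x y : ℤ⟦X⟧) : theta x y = theta y x := by
  rw [theta, ← (Equiv.neg ℤ).tsum_eq]
  exact tsum_congr fun j => thetaTerm_neg x y j

/-- The Jacobi triple product. -/
theorem theta_eq_linProd {c : ℤ} (hc : c ^ 2 = 1) {a b : ℕ} (ha : 0 < a) (hb : 0 < b) :
    theta (C c * X ^ a) (C c * X ^ b) =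
      linProd (-1) (a + b) (a + b) * (linProd c (a + b) a * linProd c (a + b) b) := by
  have hab : 0 < a + b := by lia
  have hQ : (C c * X ^ a) * (C c * X ^ b) = (X : ℤ⟦X⟧) ^ (a + b) := by
    have : (C c : ℤ⟦X⟧) ^ 2 = 1 := by rw [← map_pow, hc, map_one]
    linear_combination (X : ℤ⟦X⟧) ^ (a + b) * this
  have dvd {k : ℕ} (hk : 0 < k) : (X : ℤ⟦X⟧) ∣ C c * X ^ k :=
    (dvd_pow_self X hk.ne').mul_left _
  have h := tendsto_tripleProduct (dvd ha) (dvd hb)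
  rw [hQ] at h
  refine tendsto_nhds_unique h (Tendsto.mul ?_ ?_)
  · refine (multipliable_linProd (-1 : ℤ) hab (a + b)).hasProd.tendsto_prod_nat.congr fun n => ?_
    refine Finset.prod_congr rfl fun i _ => ?_
    rw [← pow_mul, map_neg, map_one, mul_add, mul_one]
    ring
  · refine ((multipliable_linProd c hab a).hasProd.tendsto_prod_nat.mul
      (multipliable_linProd c hab b).hasProd.tendsto_prod_nat).congr fun n => ?_
    rw [← Finset.prod_mul_distrib]
    refine Finset.prod_congr rfl fun i _ => ?_
    rw [← pow_mul]
    ring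

theorem expand_theta {x y : ℤ⟦X⟧} (hx : X ∣ x) (hy : X ∣ y) {p : ℕ} (hp : p ≠ 0) :
    expand p hp (theta x y) = theta (expand p hp x) (expand p hp y) := by
  rw [theta, (summable_thetaTerm hx hy).map_tsum _ (continuous_expand hp)]
  exact tsum_congr fun j => by simp [thetaTerm]

theorem hasSum_of_residues {M : Type*} [AddCommMonoid M] [TopologicalSpace M] [ContinuousAdd M]
    {m : ℤ} (hm : m ≠ 0) {s : Finset ℤ} (hs : ∀ j : ℤ, ∃! r, r ∈ s ∧ m ∣ j - r) {g a : ℤ → M}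
    (h : ∀ r ∈ s, HasSum (fun k => g (m * k + r)) (a r)) : HasSum g (∑ r ∈ s, a r) := by
  -- Extend each residue class by zero to all of ℤ; the extensions add up to g.
  have key (r : ℤ) (hr : r ∈ s) : HasSum (fun j => if m ∣ j - r then g j else 0) (a r) := by
    have hinj : Function.Injective fun k : ℤ => m * k + r := fun k l hkl =>
      mul_left_cancel₀ hm (add_right_cancel hkl)
    refine (hinj.hasSum_iff fun j hj => if_neg ?_).mp ?_
    · rintro ⟨k, hk⟩
      exact hj ⟨k, by lia⟩
    · simpa [Function.comp_def] using h r hr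
  convert! hasSum_sum key using 1
  funext j
  obtain ⟨r, ⟨hr, hrj⟩, hu⟩ := hs j
  rw [Finset.sum_eq_single_of_mem r hr fun t ht htr => if_neg fun htj => htr (hu t ⟨ht, htj⟩),
    if_pos hrj]

/-- The splitting of `theta x (x c)` according to the parity of the summation index. -/
theorem theta_two_dissection {x c : ℤ⟦X⟧} (hx : X ∣ x) (hc : X ∣ c) :
    theta x (x * c) = theta (x ^ 4 * c) (x ^ 4 * c ^ 3) + x * theta (x ^ 8 * c ^ 3) c := by
  have hx' (k : ℕ) (hk : k ≠ 0) (y : ℤ⟦X⟧) : X ∣ x ^ k * y :=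
    (hx.trans (dvd_pow_self x hk)).mul_right y
  have h0 := (summable_thetaTerm (hx' 4 (by simp) c) (hx' 4 (by simp) (c ^ 3))).hasSum
  have h1 := ((summable_thetaTerm (hx' 8 (by simp) (c ^ 3)) hc).hasSum).mul_left x
  have e0 (k : ℤ) : thetaTerm x (x * c) (2 * k + 0) =
      thetaTerm (x ^ 4 * c) (x ^ 4 * c ^ 3) k := by
    have t := two_mul_tri k
    have t' := two_mul_tri (-k)
    have t2 := two_mul_tri (2 * k)
    have t2' := two_mul_tri (-(2 * k))
    have i1 : tri (2 * k) + tri (-(2 * k)) = 4 * tri k + 4 * tri (-k) := by zify; linarith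
    have i2 : tri (-(2 * k)) = tri k + 3 * tri (-k) := by zify; linarith
    calc _ = x ^ (tri (2 * k) + tri (-(2 * k))) * c ^ tri (-(2 * k)) := by
          rw [add_zero, thetaTerm]; ring
      _ = _ := by rw [i1, i2, thetaTerm]; ring
  have e1 (k : ℤ) : thetaTerm x (x * c) (2 * k + 1) = x * thetaTerm (x ^ 8 * c ^ 3) c k := by
    have t := two_mul_tri k
    have t' := two_mul_tri (-k)
    have t2 := two_mul_tri (2 * k + 1)
    have t2' := two_mul_tri (-(2 * k + 1))
    have i1 : tri (2 * k + 1) + tri (-(2 * k + 1)) = 1 + 8 * tri k := by zify; linarith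
    have i2 : tri (-(2 * k + 1)) = 3 * tri k + tri (-k) := by zify; linarith
    calc _ = x ^ (tri (2 * k + 1) + tri (-(2 * k + 1))) * c ^ tri (-(2 * k + 1)) := by
          rw [thetaTerm]; ring
      _ = _ := by rw [i1, i2, thetaTerm]; ring
  have key := hasSum_of_residues (m := 2) (s := {0, 1}) (g := thetaTerm x (x * c))
    (a := fun r => if r = 0 then theta (x ^ 4 * c) (x ^ 4 * c ^ 3)
      else x * theta (x ^ 8 * c ^ 3) c) (by simp) (fun j => ?_) ?_
  · rw [theta, key.tsum_eq]
    simp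
  · rcases Int.emod_two_eq_zero_or_one j with h | h
    · exact ⟨0, ⟨by simp, by lia⟩, fun r hr => by simp at hr; lia⟩
    · exact ⟨1, ⟨by simp, by lia⟩, fun r hr => by simp at hr; lia⟩
  · intro r hr
    rw [Finset.mem_insert, Finset.mem_singleton] at hr
    rcases hr with rfl | rfl
    · simp only [e0, reduceIte]
      exact h0
    · simp only [e1, one_ne_zero, reduceIte]
      exact h1

/-- The splitting of `theta x y` according to the residue of the summation index modulo `3`. -/
theorem theta_three_dissection {x y : ℤ⟦X⟧} (hx : X ∣ x) (hy : X ∣ y) :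
    theta x y = theta (x ^ 6 * y ^ 3) (x ^ 3 * y ^ 6) + x * theta (x ^ 9 * y ^ 6) (y ^ 3) +
      y * theta (x ^ 3) (x ^ 6 * y ^ 9) := by
  have hx' (k : ℕ) (hk : k ≠ 0) (z : ℤ⟦X⟧) : X ∣ x ^ k * z :=
    (hx.trans (dvd_pow_self x hk)).mul_right z
  have hx3 : X ∣ x ^ 3 := hx.trans (dvd_pow_self x (by simp))
  have hy3 : X ∣ y ^ 3 := hy.trans (dvd_pow_self y (by simp))
  have h0 := (summable_thetaTerm (hx' 6 (by simp) (y ^ 3)) (hx' 3 (by simp) (y ^ 6))).hasSum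
  have h1 := ((summable_thetaTerm (hx' 9 (by simp) (y ^ 6)) hy3).hasSum).mul_left x
  have h2 := ((summable_thetaTerm hx3 (hx' 6 (by simp) (y ^ 9))).hasSum).mul_left y
  have e0 (k : ℤ) : thetaTerm x y (3 * k + 0) =
      thetaTerm (x ^ 6 * y ^ 3) (x ^ 3 * y ^ 6) k := by
    have t := two_mul_tri k
    have t' := two_mul_tri (-k)
    have t2 := two_mul_tri (3 * k)
    have t2' := two_mul_tri (-(3 * k))
    have i1 : tri (3 * k) = 6 * tri k + 3 * tri (-k) := by zify; linarith
    have i2 : tri (-(3 * k)) = 3 * tri k + 6 * tri (-k) := by zify; linarith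
    rw [add_zero, thetaTerm, i1, i2, thetaTerm]
    ring
  have e1 (k : ℤ) : thetaTerm x y (3 * k + 1) = x * thetaTerm (x ^ 9 * y ^ 6) (y ^ 3) k := by
    have t := two_mul_tri k
    have t' := two_mul_tri (-k)
    have t2 := two_mul_tri (3 * k + 1)
    have t2' := two_mul_tri (-(3 * k + 1))
    have i1 : tri (3 * k + 1) = 1 + 9 * tri k := by zify; linarith
    have i2 : tri (-(3 * k + 1)) = 6 * tri k + 3 * tri (-k) := by zify; linarith
    rw [thetaTerm, i1, i2, thetaTerm]
    ring
  have e2 (k : ℤ) : thetaTerm x y (3 * k + -1) = y * thetaTerm (x ^ 3) (x ^ 6 * y ^ 9) k := by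
    have t := two_mul_tri k
    have t' := two_mul_tri (-k)
    have t2 := two_mul_tri (3 * k + -1)
    have t2' := two_mul_tri (-(3 * k + -1))
    have i1 : tri (3 * k + -1) = 3 * tri k + 6 * tri (-k) := by zify; linarith
    have i2 : tri (-(3 * k + -1)) = 1 + 9 * tri (-k) := by zify; linarith
    rw [thetaTerm, i1, i2, thetaTerm]
    ring
  have key := hasSum_of_residues (m := 3) (s := {0, 1, -1}) (g := thetaTerm x y)
    (a := fun r => if r = 0 then theta (x ^ 6 * y ^ 3) (x ^ 3 * y ^ 6)
      else if r = 1 then x * theta (x ^ 9 * y ^ 6) (y ^ 3)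
      else y * theta (x ^ 3) (x ^ 6 * y ^ 9)) (by simp) (fun j => ?_) ?_
  · rw [theta, key.tsum_eq]
    simp [add_assoc]
  · have : j % 3 = 0 ∨ j % 3 = 1 ∨ j % 3 = 2 := by lia
    rcases this with h | h | h
    · exact ⟨0, ⟨by simp, by lia⟩, fun r hr => by simp at hr; lia⟩
    · exact ⟨1, ⟨by simp, by lia⟩, fun r hr => by simp at hr; lia⟩
    · exact ⟨-1, ⟨by simp, by lia⟩, fun r hr => by simp at hr; lia⟩
  · intro r hr
    rw [Finset.mem_insert, Finset.mem_insert, Finset.mem_singleton] at hr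
    rcases hr with rfl | rfl | rfl
    · simp only [e0, reduceIte]
      exact h0
    · simp only [e1, one_ne_zero, reduceIte]
      exact h1
    · rw [if_neg (by decide), if_neg (by decide)]
      simp only [e2]
      exact h2

end Theta

/-! ### The 3-dissection of f₁f₂. -/

section Dissection

theorem theta_X_pow {a b : ℕ} (ha : 0 < a) (hb : 0 < b) :
    theta (X ^ a) (X ^ b) =
      linProd (-1) (a + b) (a + b) * (linProd 1 (a + b) a * linProd 1 (a + b) b) := by
  simpa using theta_eq_linProd (c := 1) (by norm_num) ha hb

theorem theta_neg_X_pow {a b : ℕ} (ha : 0 < a) (hb : 0 < b) :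
    theta (-X ^ a) (-X ^ b) =
      linProd (-1) (a + b) (a + b) * (linProd (-1) (a + b) a * linProd (-1) (a + b) b) := by
  simpa using theta_eq_linProd (c := -1) (by norm_num) ha hb

theorem theta_neg_X_neg_X_mul : theta (-X ^ 1) (-X ^ 1) * f 2 = f 1 ^ 2 := by
  rw [theta_neg_X_pow (by simp) (by simp), f_eq_linProd, f_eq_linProd,
    linProd_eq_prod (-1 : ℤ) one_pos 1 (by simp : 0 < 2)]
  simp only [Finset.prod_range_succ, Finset.prod_range_zero]
  norm_num
  ring

theorem theta_X_X_pow_three_mul : theta (X ^ 1) (X ^ 3) * f 1 = f 2 ^ 2 := by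
  have h1 := linProd_eq_prod (1 : ℤ) (by simp : 0 < 2) 1 (by simp : 0 < 2)
  have h2 := linProd_eq_prod (-1 : ℤ) one_pos 1 (by simp : 0 < 2)
  have h3 := linProd_eq_prod (-1 : ℤ) (by simp : 0 < 2) 2 (by simp : 0 < 2)
  have h4 := linProd_mul_linProd_neg (1 : ℤ) (by simp : 0 < 2) 1
  rw [theta_X_pow (by simp) (by simp), f_eq_linProd, f_eq_linProd]
  simp only [Finset.prod_range_succ, Finset.prod_range_zero] at h1 h2 h3
  norm_num at h1 h2 h3 h4 ⊢
  rw [← h1, h2]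
  linear_combination linProd (-1) 4 4 * linProd (-1) 2 2 * h4 - linProd (-1) 2 2 * h3

theorem theta_neg_X_neg_X_pow_five_mul :
    theta (-X ^ 1) (-X ^ 5) * (f 2 * f 3) = f 1 * f 6 ^ 2 := by
  rw [theta_neg_X_pow (by simp) (by simp), f_eq_linProd, f_eq_linProd, f_eq_linProd, f_eq_linProd,
    linProd_eq_prod (-1 : ℤ) one_pos 1 (by simp : 0 < 6),
    linProd_eq_prod (-1 : ℤ) (by simp : 0 < 2) 2 (by simp : 0 < 3),
    linProd_eq_prod (-1 : ℤ) (by simp : 0 < 3) 3 (by simp : 0 < 2)]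
  simp only [Finset.prod_range_succ, Finset.prod_range_zero]
  norm_num
  ring

theorem theta_X_X_sq_mul : theta (X ^ 1) (X ^ 2) * (f 1 * f 6) = f 2 * f 3 ^ 2 := by
  have h1 := linProd_eq_prod (1 : ℤ) one_pos 1 (by simp : 0 < 3)
  have h4 := linProd_mul_linProd_neg (1 : ℤ) one_pos 1
  have h5 := linProd_mul_linProd_neg (1 : ℤ) (by simp : 0 < 3) 3
  rw [theta_X_pow (by simp) (by simp), f_eq_linProd, f_eq_linProd, f_eq_linProd, f_eq_linProd]
  simp only [Finset.prod_range_succ, Finset.prod_range_zero] at h1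
  norm_num at h1 h4 h5 ⊢
  rw [← h5, ← h4, h1]
  ring

theorem theta_neg_X_neg_X_mul_theta_X_X_pow_three : theta (-X ^ 1) (-X ^ 1) * theta (X ^ 1) (X ^ 3) = f 1 * f 2 := by
  refine mul_right_cancel₀ (mul_ne_zero (f_ne_zero one_pos) (f_ne_zero (by simp : 0 < 2))) ?_
  linear_combination theta (X ^ 1) (X ^ 3) * f 1 * theta_neg_X_neg_X_mul +
    f 1 ^ 2 * theta_X_X_pow_three_mul

theorem theta_X_X_sq_mul_theta_neg_X_neg_X_pow_five : theta (X ^ 1) (X ^ 2) * theta (-X ^ 1) (-X ^ 5) = f 3 * f 6 := by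
  refine mul_right_cancel₀ (mul_ne_zero (mul_ne_zero (f_ne_zero one_pos) (f_ne_zero (by simp : 0 < 2)))
    (mul_ne_zero (f_ne_zero (by simp : 0 < 3)) (f_ne_zero (k := 6) (by simp)))) ?_
  linear_combination theta (-X ^ 1) (-X ^ 5) * (f 2 * f 3) * theta_X_X_sq_mul +
    f 2 * f 3 ^ 2 * theta_neg_X_neg_X_pow_five_mul

theorem expand_theta_X_pow {a b p : ℕ} (ha : a ≠ 0) (hb : b ≠ 0) (hp : p ≠ 0) :
    expand p hp (theta (X ^ a) (X ^ b)) = theta (X ^ (p * a)) (X ^ (p * b)) := by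
  rw [expand_theta (dvd_pow_self X ha) (dvd_pow_self X hb)]
  simp [pow_mul]

theorem expand_theta_neg_X_pow {a b p : ℕ} (ha : a ≠ 0) (hb : b ≠ 0) (hp : p ≠ 0) :
    expand p hp (theta (-X ^ a) (-X ^ b)) = theta (-X ^ (p * a)) (-X ^ (p * b)) := by
  rw [expand_theta (dvd_neg.mpr (dvd_pow_self X ha)) (dvd_neg.mpr (dvd_pow_self X hb))]
  simp [pow_mul]

theorem theta_neg_X_dissection : theta (-X ^ 1) (-X ^ 1) =
    theta (-X ^ 9) (-X ^ 9) - 2 * X * theta (-X ^ 3) (-X ^ 15) := by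
  have h : (X : ℤ⟦X⟧) ∣ -X ^ 1 := by simp
  rw [theta_three_dissection h h, theta_comm ((-X ^ 1) ^ 9 * (-X ^ 1) ^ 6),
    show (-X ^ 1 : ℤ⟦X⟧) ^ 6 * (-X ^ 1) ^ 3 = -X ^ 9 by ring,
    show (-X ^ 1 : ℤ⟦X⟧) ^ 3 * (-X ^ 1) ^ 6 = -X ^ 9 by ring,
    show (-X ^ 1 : ℤ⟦X⟧) ^ 9 * (-X ^ 1) ^ 6 = -X ^ 15 by ring,
    show (-X ^ 1 : ℤ⟦X⟧) ^ 6 * (-X ^ 1) ^ 9 = -X ^ 15 by ring,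
    show (-X ^ 1 : ℤ⟦X⟧) ^ 3 = -X ^ 3 by ring]
  ring

/-- Of the three pieces modulo 3, those of residues 0 and -1 are the even and odd parts of `theta (X
^ 3) (X ^ 6)`. -/
theorem theta_X_dissection : theta (X ^ 1) (X ^ 3) =
    theta (X ^ 3) (X ^ 6) + X * theta (X ^ 9) (X ^ 27) := by
  have h (k : ℕ) (hk : k ≠ 0) : (X : ℤ⟦X⟧) ∣ X ^ k := dvd_pow_self X hk
  have h2 := theta_two_dissection (h 3 (by simp)) (h 3 (by simp))
  rw [theta_three_dissection (h 1 (by simp)) (h 3 (by simp)), theta_comm ((X ^ 1) ^ 9 * _),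
    theta_comm ((X ^ 1) ^ 3)]
  simp only [← pow_mul, ← pow_add] at h2 ⊢
  norm_num at h2 ⊢
  rw [h2]
  ring

/-- The 3-dissection of `f 1 * f 2`. -/
theorem exists_dissection : ∃ A B : ℤ⟦X⟧, A * B = (f 3 * f 6) ^ 2 ∧
    f 1 * f 2 = expand 3 three_ne_zero A - X * expand 3 three_ne_zero (f 3 * f 6) -
      2 * X ^ 2 * expand 3 three_ne_zero B := by
  have h1 : theta (-X ^ 3) (-X ^ 3) * theta (X ^ 3) (X ^ 9) = f 3 * f 6 := by
    have := congrArg (expand 3 three_ne_zero) theta_neg_X_neg_X_mul_theta_X_X_pow_three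
    rwa [map_mul, map_mul, expand_f one_pos, expand_f (by simp : 0 < 2),
      expand_theta_X_pow (by simp) (by simp), expand_theta_neg_X_pow (by simp) (by simp)] at this
  have h2 := theta_X_X_sq_mul_theta_neg_X_neg_X_pow_five
  refine ⟨theta (X ^ 1) (X ^ 2) * theta (-X ^ 3) (-X ^ 3),
    theta (-X ^ 1) (-X ^ 5) * theta (X ^ 3) (X ^ 9), ?_, ?_⟩
  · linear_combination h1 * theta (X ^ 1) (X ^ 2) * theta (-X ^ 1) (-X ^ 5) + f 3 * f 6 * h2
  · have e1 := congrArg (expand 3 three_ne_zero) h1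
    have e2 := congrArg (expand 3 three_ne_zero) h2
    rw [← theta_neg_X_neg_X_mul_theta_X_X_pow_three, theta_neg_X_dissection, theta_X_dissection]
    rw [map_mul] at e1 e2
    simp only [map_mul _ (theta _ _) (theta _ _)]
    rw [expand_theta_X_pow (by simp) (by simp), expand_theta_neg_X_pow (by simp) (by simp)] at e1 e2 ⊢
    rw [expand_theta_X_pow (by simp) (by simp), expand_theta_neg_X_pow (by simp) (by simp)]
    -- Both cross terms are multiples of q·f₉f₁₈, with coefficients 1 and -2; hence the middle
    -- coefficient -1.
    linear_combination X * e1 - 2 * X * e2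

end Dissection

/-! ### Products over q ↦ ωⁱq and the cubic relation. -/

section Norm

theorem map_linProd {R : Type*} [CommRing R] [TopologicalSpace R] [DiscreteTopology R]
    (φ : ℤ →+* R) (c : ℤ) {a : ℕ} (ha : 0 < a) (b : ℕ) :
    map φ (linProd c a b) = linProd (φ c) a b := by
  simpa using rescale_map_linProd φ c (z := 1) ha (by simp) b

theorem norm_linProd_of_dvd {R : Type*} [CommRing R] [TopologicalSpace R] [DiscreteTopology R]
    (φ : ℤ →+* R) {ω : R} (hω : ω ^ 2 + ω + 1 = 0) {a b : ℕ} (ha : 0 < a) (ha3 : 3 ∣ a)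
    (hb : 3 ∣ b) :
    map φ (linProd (-1) a b) * rescale ω (map φ (linProd (-1) a b)) *
      rescale (ω ^ 2) (map φ (linProd (-1) a b)) = map φ (linProd (-1) a b) ^ 3 := by
  have h3 : ω ^ 3 = 1 := by linear_combination (ω - 1) * hω
  have hpow {n : ℕ} (hn : 3 ∣ n) : ω ^ n = 1 := by
    obtain ⟨n, rfl⟩ := hn
    rw [pow_mul, h3, one_pow]
  rw [rescale_map_linProd φ _ ha (hpow ha3),
    rescale_map_linProd φ _ ha (by rw [pow_right_comm, hpow ha3, one_pow]),
    map_linProd φ _ ha, pow_right_comm, hpow hb]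
  simp only [one_pow, mul_one]
  ring

theorem norm_linProd_of_not_dvd {R : Type*} [CommRing R] [TopologicalSpace R] [DiscreteTopology R]
    (φ : ℤ →+* R) {ω : R} (hω : ω ^ 2 + ω + 1 = 0) {a b : ℕ} (ha : 0 < a) (ha3 : 3 ∣ a)
    (hb : ¬ 3 ∣ b) :
    map φ (linProd (-1) a b) * rescale ω (map φ (linProd (-1) a b)) *
      rescale (ω ^ 2) (map φ (linProd (-1) a b)) = map φ (linProd (-1) (3 * a) (3 * b)) := by
  have h3 : ω ^ 3 = 1 := by linear_combination (ω - 1) * hω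
  have key := linProd_mul_linProd_mul_linProd hω ha b
  have hpow : ω ^ a = 1 := by
    obtain ⟨a, rfl⟩ := ha3
    rw [pow_mul, h3, one_pow]
  rw [rescale_map_linProd φ _ ha hpow,
    rescale_map_linProd φ _ ha (by rw [pow_right_comm, hpow, one_pow]),
    map_linProd φ _ ha, map_linProd φ _ (by lia), pow_right_comm, pow_eq_pow_mod b h3, map_neg,
    map_one, ← key, neg_one_mul, neg_one_mul]
  have hb' : b % 3 = 1 ∨ b % 3 = 2 := by lia
  rcases hb' with h | h
  · rw [h, pow_one]
  · rw [h, show (ω ^ 2) ^ 2 = ω by linear_combination ω * h3]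
    ring

/-- The product of `f k` over the three substitutions `q ↦ ω ^ i q`. -/
theorem norm_f {R : Type*} [CommRing R] [TopologicalSpace R] [DiscreteTopology R]
    (φ : ℤ →+* R) {ω : R} (hω : ω ^ 2 + ω + 1 = 0) {k : ℕ} (hk : ¬ 3 ∣ k) :
    map φ (f k) * rescale ω (map φ (f k)) * rescale (ω ^ 2) (map φ (f k)) * map φ (f (9 * k)) =
      map φ (f (3 * k)) ^ 4 := by
  have hk0 : 0 < k := by lia
  -- The first two factors have exponents prime to 3, so their norms are their images under q ↦ q³;
  -- `f (3 * k)` is fixed by q ↦ ωq and gets cubed.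
  have e1 : f k = linProd (-1) (3 * k) k * linProd (-1) (3 * k) (2 * k) * f (3 * k) := by
    rw [f_eq_linProd, f_eq_linProd, linProd_eq_prod (-1 : ℤ) hk0 k (by simp : 0 < 3)]
    simp only [Finset.prod_range_succ, Finset.prod_range_zero]
    ring_nf
  have e2 := congrArg (expand 3 three_ne_zero) e1
  rw [map_mul, map_mul, expand_f hk0, expand_f (by lia), expand_linProd _ (by lia),
    expand_linProd _ (by lia)] at e2
  have n1 := norm_linProd_of_not_dvd φ hω (a := 3 * k) (b := k) (by lia) (by simp) hk
  have n2 := norm_linProd_of_not_dvd φ hω (a := 3 * k) (b := 2 * k) (by lia) (by simp) (by lia)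
  have n3 := norm_linProd_of_dvd φ hω (a := 3 * k) (b := 3 * k) (by lia) (by simp) (by simp)
  rw [← f_eq_linProd] at n3
  have e3 := congrArg (map φ) e2
  rw [map_mul, map_mul, show 3 * (3 * k) = 9 * k by ring] at e3
  rw [show 3 * (3 * k) = 9 * k by ring] at n1 n2
  calc _ = (map φ (linProd (-1) (3 * k) k) * rescale ω (map φ (linProd (-1) (3 * k) k)) *
      rescale (ω ^ 2) (map φ (linProd (-1) (3 * k) k))) *
      (map φ (linProd (-1) (3 * k) (2 * k)) * rescale ω (map φ (linProd (-1) (3 * k) (2 * k))) *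
      rescale (ω ^ 2) (map φ (linProd (-1) (3 * k) (2 * k)))) *
      (map φ (f (3 * k)) * rescale ω (map φ (f (3 * k))) *
      rescale (ω ^ 2) (map φ (f (3 * k)))) * map φ (f (9 * k)) := by
        nth_rw 1 2 3 [e1]
        simp only [map_mul]
        ring
    _ = _ := by
        rw [n1, n2, n3]
        linear_combination -map φ (f (3 * k)) ^ 3 * e3

theorem rescale_map_expand {R : Type*} [CommRing R] (φ : ℤ →+* R) {z : R} (hz : z ^ 3 = 1)
    (g : ℤ⟦X⟧) :
    rescale z (map φ (expand 3 three_ne_zero g)) = map φ (expand 3 three_ne_zero g) := by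
  ext n
  rw [coeff_rescale, coeff_map, coeff_expand]
  split_ifs with h
  · obtain ⟨n, rfl⟩ := h
    rw [pow_mul, hz, one_pow, one_mul]
  · simp

/-- The product of f₁f₂ over q ↦ ωⁱq is computed twice: from `norm_f`, and from the 3-dissection. -/
theorem cubic_relation_map {R : Type*} [CommRing R]
    (φ : ℤ →+* R) {ω : R} (hω : ω ^ 2 + ω + 1 = 0) :
    map φ (((f 1 * f 2) ^ 3 + 3 * (X * (f 9 * f 18)) * (f 1 * f 2) ^ 2 +
      9 * (X * (f 9 * f 18)) ^ 2 * (f 1 * f 2)) * (f 9 * f 18)) = map φ ((f 3 * f 6) ^ 4) := by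
  -- The product lemmas need a discrete ring. The identity itself involves no topology on R, so it
  -- can later be used over ℂ.
  let _ : TopologicalSpace R := ⊥
  have _ : DiscreteTopology R := ⟨rfl⟩
  have h3 : ω ^ 3 = 1 := by linear_combination (ω - 1) * hω
  have h3' : (ω ^ 2) ^ 3 = 1 := by rw [pow_right_comm, h3, one_pow]
  have hω' : (C ω) ^ 2 + C ω + 1 = (0 : R⟦X⟧) := by
    rw [← map_pow, ← map_add, ← map_one C, ← map_add, hω, map_zero]
  obtain ⟨A, B, hAB, he⟩ := exists_dissection
  have hG : expand 3 three_ne_zero (f 3 * f 6) = f 9 * f 18 := by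
    rw [map_mul, expand_f (by simp), expand_f (by simp)]
  have hAB' := congrArg (fun g => map φ (expand 3 three_ne_zero g)) hAB
  simp only [map_mul _ A B, map_mul _ (expand 3 _ A), map_pow _ (f 3 * f 6), map_pow _ (expand 3 _ _)] at hAB'
  have n1 := norm_f φ hω (k := 1) (by simp)
  have n2 := norm_f φ hω (k := 2) (by simp)
  have conj (z : R) (hz : z ^ 3 = 1) : rescale z (map φ (f 1)) * rescale z (map φ (f 2)) =
      map φ (expand 3 three_ne_zero A) - C z * X * map φ (expand 3 three_ne_zero (f 3 * f 6)) -
        2 * (C z * X) ^ 2 * map φ (expand 3 three_ne_zero B) := by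
    rw [← map_mul, ← map_mul, he]
    generalize hA : expand 3 three_ne_zero A = a
    generalize hB : expand 3 three_ne_zero B = b
    generalize hg : expand 3 three_ne_zero (f 3 * f 6) = g
    simp only [map_sub, map_mul, map_pow, map_ofNat, map_X, rescale_X]
    rw [← hA, ← hB, ← hg, rescale_map_expand φ hz, rescale_map_expand φ hz,
      rescale_map_expand φ hz]
  have r0 := conj 1 (by simp)
  have r1 := conj ω h3
  have r2 := conj (ω ^ 2) h3'
  rw [rescale_one, RingHom.id_apply, RingHom.id_apply, map_one, one_mul] at r0
  rw [map_pow] at r2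
  rw [hG] at r0 r1 r2 hAB'
  simp only [map_mul, map_add, map_pow, map_X, map_ofNat] at n1 n2 r0 r1 r2 hAB' ⊢
  norm_num at n1 n2
  generalize map φ (expand 3 three_ne_zero A) = a at *
  generalize map φ (expand 3 three_ne_zero B) = b at *
  generalize (C ω : R⟦X⟧) = w at *
  generalize rescale ω (map φ (f 1)) = f11 at *
  generalize rescale ω (map φ (f 2)) = f21 at *
  generalize rescale (ω ^ 2) (map φ (f 1)) = f12 at *
  generalize rescale (ω ^ 2) (map φ (f 2)) = f22 at *
  generalize map φ (f 1) = f1 at *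
  generalize map φ (f 2) = f2 at *
  generalize map φ (f 3) = f3 at *
  generalize map φ (f 6) = f6 at *
  generalize map φ (f 9) = f9 at *
  generalize map φ (f 18) = f18 at *
  generalize (X : R⟦X⟧) = x at *
  -- With f₁f₂ = a - p - s, the conjugates are a - ωp - ω²s and a - ω²p - ωs; the relation as = 2p²
  -- eliminates a and s from their product.
  have r12 : (f11 * f21) * (f12 * f22) =
      (f1 * f2) ^ 2 + 3 * (x * (f9 * f18)) * (f1 * f2) + 9 * (x * (f9 * f18)) ^ 2 := by
    rw [r0, r1, r2]
    generalize hp : x * (f9 * f18) = p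
    generalize hs : 2 * x ^ 2 * b = s
    have has : a * s = 2 * p ^ 2 := by
      rw [← hp, ← hs]
      linear_combination 2 * x ^ 2 * hAB'
    have h1 : a - w * x * (f9 * f18) - 2 * (w * x) ^ 2 * b = a - w * p - w ^ 2 * s := by
      rw [← hp, ← hs]
      ring
    have h2 : a - w ^ 2 * x * (f9 * f18) - 2 * (w ^ 2 * x) ^ 2 * b =
        a - w ^ 2 * p - w ^ 4 * s := by
      rw [← hp, ← hs]
      ring
    rw [h1, h2]
    linear_combination (-a * p - a * s + (p ^ 2 + s ^ 2) * (w - 1) + p * s * (1 + w * (w - 1)) -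
      s * w * (w - 1) * (a - w * p - w ^ 2 * s)) * hω' + 3 * has
  calc _ = (f1 * f11 * f12 * f9) * (f2 * f21 * f22 * f18) := by
        linear_combination (-f1 * f2 * f9 * f18) * r12
    _ = _ := by rw [n1, n2]; ring

theorem cubic_relation :
    ((f 1 * f 2) ^ 3 + 3 * (X * (f 9 * f 18)) * (f 1 * f 2) ^ 2 +
      9 * (X * (f 9 * f 18)) ^ 2 * (f 1 * f 2)) * (f 9 * f 18) = (f 3 * f 6) ^ 4 := by
  have hω := Complex.isPrimitiveRoot_exp 3 three_ne_zero
  have h := cubic_relation_map (Int.castRingHom ℂ) (ω := Complex.exp (2 * Real.pi * Complex.I / 3)) (by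
    have := hω.geom_sum_eq_zero (by simp)
    norm_num at this
    simp only [Finset.sum_range_succ, Finset.sum_range_zero] at this
    linear_combination this)
  exact map_injective _ Int.cast_injective h

end Norm

/-! ### The operator extracting exponents divisible by 3. -/

section Sift

/-- The operator `∑ a n q ^ n ↦ ∑ a (3 n) q ^ n` on power series. -/
noncomputable def sift (g : ℤ⟦X⟧) : ℤ⟦X⟧ := mk fun n => coeff (3 * n) g

theorem coeff_sift (n : ℕ) (g : ℤ⟦X⟧) : coeff n (sift g) = coeff (3 * n) g := coeff_mk _ _

theorem coeff_sift_iterate (k n : ℕ) (g : ℤ⟦X⟧) :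
    coeff n (sift^[k] g) = coeff (3 ^ k * n) g := by
  induction k generalizing n with
  | zero => simp
  | succ k ih => rw [Function.iterate_succ_apply', coeff_sift, ih]; ring_nf

theorem sift_add (g h : ℤ⟦X⟧) : sift (g + h) = sift g + sift h := by
  ext n
  simp [coeff_sift]

/-- Series in q³ act as scalars: only exponents of h divisible by 3 can contribute. -/
theorem sift_expand_mul (g h : ℤ⟦X⟧) :
    sift (expand 3 three_ne_zero g * h) = g * sift h := by
  ext n
  rw [coeff_sift, coeff_mul, coeff_mul]
  symm
  refine Finset.sum_of_injOn (fun p => (3 * p.1, 3 * p.2)) ?_ ?_ ?_ ?_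
  · intro p _ q _ h
    simp only [Prod.mk.injEq] at h
    ext <;> lia
  · intro p hp
    rw [Finset.mem_coe, Finset.HasAntidiagonal.mem_antidiagonal] at hp ⊢
    lia
  · intro p hp hp'
    rw [coeff_expand]
    split_ifs with h
    · obtain ⟨k, hk⟩ := h
      rw [Finset.HasAntidiagonal.mem_antidiagonal] at hp
      refine absurd ⟨(k, n - k), ?_, ?_⟩ hp'
      · rw [Finset.mem_coe, Finset.HasAntidiagonal.mem_antidiagonal]
        lia
      · ext <;> simp <;> lia
    · simp
  · intro p _
    rw [coeff_expand_mul, coeff_sift]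

theorem sift_expand (g : ℤ⟦X⟧) : sift (expand 3 three_ne_zero g) = g := by
  ext n
  rw [coeff_sift, coeff_expand_mul]

theorem sift_expand_mul_X_pow (g : ℤ⟦X⟧) {k : ℕ} (hk : ¬ 3 ∣ k) :
    sift (expand 3 three_ne_zero g * X ^ k) = 0 := by
  have : sift (X ^ k : ℤ⟦X⟧) = 0 := by
    ext n
    rw [coeff_sift, coeff_X_pow, if_neg (fun h => hk ⟨n, h.symm⟩), map_zero]
  rw [sift_expand_mul, this, mul_zero]

end Sift

/-! ### The modular equation of degree three. -/

section ModularEquation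

/-- The modular equation of degree three for `F = q f₉ f₁₈ / (f₁ f₂)` and
`t = q (f₃ f₆) ^ 4 / (f₁ f₂) ^ 4`, stated for `e = f₁ f₂`, `H = f₃ f₆`, and `I = 1 / e`. -/
theorem modular_equation {e H I A B : ℤ⟦X⟧} (heI : e * I = 1)
    (hH : expand 3 three_ne_zero e = H) {G : ℤ⟦X⟧} (hG : expand 3 three_ne_zero H = G)
    (hc : (e ^ 3 + 3 * (X * G) * e ^ 2 + 9 * (X * G) ^ 2 * e) * G = H ^ 4)
    (hAB : A * B = H ^ 2)
    (he : e = expand 3 three_ne_zero A - X * G - 2 * X ^ 2 * expand 3 three_ne_zero B)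
    {F t : ℤ⟦X⟧} (hF : F = X * G * I) (ht : t = X * H ^ 4 * I ^ 4) :
    t = F * (1 + 3 * F + 9 * F ^ 2) ∧
    F ^ 3 = expand 3 three_ne_zero t * (1 + 3 * F + 9 * F ^ 2) ∧
    sift F = 3 * t ∧ sift (F ^ 2) = 2 * t + 27 * t ^ 2 := by
  have hHJ := congrArg (expand 3 three_ne_zero) heI
  rw [map_mul, map_one, hH] at hHJ
  have hab := congrArg (expand 3 three_ne_zero) hAB
  rw [map_mul, map_pow, hG] at hab
  have ht3 : expand 3 three_ne_zero t = X ^ 3 * G ^ 4 * expand 3 three_ne_zero I ^ 4 := by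
    rw [ht, map_mul, map_mul, map_pow _ H, hG, expand_X, map_pow]
  have hHJ4 : H ^ 4 * expand 3 three_ne_zero I ^ 4 = 1 := by rw [← mul_pow, hHJ, one_pow]
  have hI3 : G * (1 + 3 * (X * G * I) + 9 * (X * G * I) ^ 2) = H ^ 4 * I ^ 3 := by
    linear_combination I ^ 3 * hc - G * ((1 + e * I + e ^ 2 * I ^ 2) +
      3 * (X * G) * I * (1 + e * I) + 9 * (X * G) ^ 2 * I ^ 2) * heI
  have hI2 : G * (e + 3 * (X * G) + 9 * (X * G) ^ 2 * I) = H ^ 4 * I ^ 2 := by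
    linear_combination e * hI3 -
      (G * (3 * (X * G) + 9 * (X * G) ^ 2 * I) - H ^ 4 * I ^ 2) * heI
  have hI1 : G * (e ^ 2 + 3 * (X * G) * e + 9 * (X * G) ^ 2) = H ^ 4 * I := by
    linear_combination e * hI2 - (G * 9 * (X * G) ^ 2 - H ^ 4 * I) * heI
  have s1 : sift F = 3 * t := by
    -- By `hI1`, F = qG·I(q³)⁴·G(e² + 3qGe + 9q²G²). Substituting the dissection of e and A(q³)B(q³)
    -- = G² sorts this by residue of the exponent modulo 3.
    have : F = expand 3 three_ne_zero (I ^ 4 * H ^ 2 * (A ^ 2 - 2 * X * H * B)) * X ^ 1 +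
        expand 3 three_ne_zero (I ^ 4 * H ^ 2 * (A * H + 4 * X * B ^ 2)) * X ^ 2 +
        expand 3 three_ne_zero (3 * t) := by
      simp only [map_mul, map_sub, map_add, map_pow, map_ofNat, ht3, expand_X, hG]
      rw [hF]
      rw [he] at hI1
      linear_combination -X * G * I * hHJ4 - X * G * expand 3 three_ne_zero I ^ 4 * hI1 -
        4 * X ^ 3 * G ^ 2 * expand 3 three_ne_zero I ^ 4 * hab
    rw [this, sift_add, sift_add, sift_expand, sift_expand_mul_X_pow _ (by simp),
      sift_expand_mul_X_pow _ (by simp), zero_add, zero_add]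
  refine ⟨?_, ?_, s1, ?_⟩
  · rw [hF, ht]
    linear_combination -X * I * hI3
  · rw [ht3, hF]
    linear_combination -X ^ 3 * G ^ 3 * I ^ 3 * hHJ4 -
      X ^ 3 * G ^ 3 * expand 3 three_ne_zero I ^ 4 * hI3
  -- Likewise `hI2` makes F² equal to q²G²·I(q³)⁴·G(e + 3qG + 9qG·F), where e is dissected and the
  -- last F is kept.
  · have : F ^ 2 = expand 3 three_ne_zero (2 * t) + expand 3 three_ne_zero (9 * t) * F +
        expand 3 three_ne_zero (H ^ 3 * I ^ 4 * A) * X ^ 2 +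
        expand 3 three_ne_zero (-(2 * X * H ^ 3 * I ^ 4 * B)) * X ^ 1 := by
      simp only [map_mul, map_neg, map_pow, map_ofNat, ht3, expand_X, hG]
      rw [hF]
      linear_combination -X ^ 2 * G ^ 2 * I ^ 2 * hHJ4 -
        X ^ 2 * G ^ 2 * expand 3 three_ne_zero I ^ 4 * hI2 +
        X ^ 2 * G ^ 3 * expand 3 three_ne_zero I ^ 4 * he
    rw [this, sift_add, sift_add, sift_add, sift_expand, sift_expand_mul, s1,
      sift_expand_mul_X_pow _ (by simp), sift_expand_mul_X_pow _ (by simp)]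
    ring

theorem exists_modular_equation : ∃ t : ℤ⟦X⟧,
    t = X * genFun9 * (1 + 3 * (X * genFun9) + 9 * (X * genFun9) ^ 2) ∧
    (X * genFun9) ^ 3 = expand 3 three_ne_zero t *
      (1 + 3 * (X * genFun9) + 9 * (X * genFun9) ^ 2) ∧
    sift (X * genFun9) = 3 * t ∧ sift ((X * genFun9) ^ 2) = 2 * t + 27 * t ^ 2 := by
  have hG : expand 3 three_ne_zero (f 3 * f 6) = f 9 * f 18 := by
    rw [map_mul, expand_f (by simp), expand_f (by simp)]
  obtain ⟨A, B, hAB, he⟩ := exists_dissection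
  exact ⟨_, modular_equation (I := invOfUnit (f 1 * f 2) 1)
    (mul_invOfUnit _ _ (by simp [constantCoeff_f]))
    (by rw [map_mul, expand_f (by simp), expand_f (by simp)]) hG cubic_relation hAB
    (by rw [← hG, ← he]) (by rw [genFun9, mul_assoc X]) rfl⟩

end ModularEquation

/-! ### Gaining a factor 3 at each sifting. -/

section Descent

-- Scaling by 3 absorbs the coefficients: in terms of 3F the relations are integral with spare
-- powers of 3, and each sifting can give one up.
open Polynomial in
theorem exists_sift_mul_aeval {F t : ℤ⟦X⟧} (ht : t = F * (1 + 3 * F + 9 * F ^ 2))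
    (hF : F ^ 3 = expand 3 three_ne_zero t * (1 + 3 * F + 9 * F ^ 2))
    (h1 : sift F = 3 * t) (h2 : sift (F ^ 2) = 2 * t + 27 * t ^ 2) (p : ℤ[X]) :
    ∃ r : ℤ[X], sift (3 * t * aeval (3 * t) p) = 3 * (3 * t * aeval (3 * t) r) := by
  have hnat (c : ℕ) (g : ℤ⟦X⟧) : sift (c * g) = c * sift g := by
    simpa using sift_expand_mul (c : ℤ⟦X⟧) g
  have hint (c : ℤ) (g : ℤ⟦X⟧) : sift (c * g) = c * sift g := by
    simpa using sift_expand_mul (c : ℤ⟦X⟧) g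
  have step (g : ℤ⟦X⟧) : sift ((3 * F) ^ 3 * g) =
      9 * (3 * t * (sift g + sift (3 * F * g) + sift ((3 * F) ^ 2 * g))) := by
    have : (3 * F) ^ 3 * g = expand 3 three_ne_zero (27 * t) *
        (g + 3 * F * g + (3 * F) ^ 2 * g) := by
      rw [map_mul, map_ofNat]
      linear_combination 27 * g * hF
    rw [this, sift_expand_mul, sift_add, sift_add]
    ring
  have hpow (k : ℕ) : ∃ r : ℤ[X], sift ((3 * F) ^ (k + 1)) = 3 * (3 * t * aeval (3 * t) r) := by
    have s1 : sift (3 * F) = 3 * (3 * t) := by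
      have := hnat 3 F
      push_cast at this
      rw [this, h1]
    have s2 : sift ((3 * F) ^ 2) = 3 * (3 * t * (2 + 9 * (3 * t))) := by
      have := hnat 9 (F ^ 2)
      push_cast at this
      rw [mul_pow, show (3 : ℤ⟦X⟧) ^ 2 = 9 by norm_num, this, h2]
      ring
    induction k using Nat.strong_induction_on with
    | _ k ih =>
      match k with
      | 0 => exact ⟨1, by simpa using s1⟩
      | 1 => exact ⟨2 + 9 * Polynomial.X, by simpa [map_ofNat] using s2⟩
      | 2 =>
        -- The cube is separate because the recurrence then involves `sift 1 = 1`, which is not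
        -- covered by the induction hypothesis.
        refine ⟨3 * (1 + 3 * Polynomial.X * (1 + 2 + 9 * Polynomial.X)), ?_⟩
        have := step 1
        have s0 : sift 1 = 1 := by simpa using sift_expand 1
        rw [mul_one, mul_one, mul_one, s0, s1, s2] at this
        rw [this]
        simp [map_ofNat]
        ring
      | k + 3 =>
        obtain ⟨r0, hr0⟩ := ih k (by lia)
        obtain ⟨r1, hr1⟩ := ih (k + 1) (by lia)
        obtain ⟨r2, hr2⟩ := ih (k + 2) (by lia)
        refine ⟨9 * (Polynomial.X * (r0 + r1 + r2)), ?_⟩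
        rw [show (3 * F) ^ (k + 3 + 1) = (3 * F) ^ 3 * (3 * F) ^ (k + 1) by ring, step, hr0,
          show 3 * F * (3 * F) ^ (k + 1) = (3 * F) ^ (k + 1 + 1) by ring, hr1,
          show (3 * F) ^ 2 * (3 * F) ^ (k + 1) = (3 * F) ^ (k + 2 + 1) by ring, hr2]
        simp [map_ofNat]
        ring
  have hpoly (p : ℤ[X]) :
      ∃ r : ℤ[X], sift (3 * F * aeval (3 * F) p) = 3 * (3 * t * aeval (3 * t) r) := by
    induction p using Polynomial.induction_on' with
    | add p q hp hq =>
      obtain ⟨r, hr⟩ := hp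
      obtain ⟨s, hs⟩ := hq
      exact ⟨r + s, by rw [map_add, mul_add, sift_add, hr, hs, map_add]; ring⟩
    | monomial k c =>
      obtain ⟨r, hr⟩ := hpow k
      refine ⟨Polynomial.C c * r, ?_⟩
      rw [aeval_monomial, show 3 * F * (algebraMap ℤ ℤ⟦X⟧ c * (3 * F) ^ k) =
        (c : ℤ⟦X⟧) * (3 * F) ^ (k + 1) by simp; ring, hint, hr]
      simp
      ring
  have ht' : 3 * t = aeval (3 * F) (Polynomial.X + Polynomial.X ^ 2 + Polynomial.X ^ 3 : ℤ[X]) := by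
    rw [ht]
    simp
    ring
  obtain ⟨r, hr⟩ := hpoly ((1 + Polynomial.X + Polynomial.X ^ 2) *
    p.comp (Polynomial.X + Polynomial.X ^ 2 + Polynomial.X ^ 3))
  refine ⟨r, ?_⟩
  rw [← hr, map_mul, aeval_comp, ← ht']
  congr 1
  rw [ht]
  simp
  ring

theorem three_pow_dvd_sift_iterate (k : ℕ) :
    ∃ g : ℤ⟦X⟧, sift^[k + 1] (X * genFun9) = 3 ^ (k + 1) * g := by
  obtain ⟨t, ht, hF, h1, h2⟩ := exists_modular_equation
  have key : ∃ r : Polynomial ℤ, sift^[k + 1] (X * genFun9) =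
      3 ^ k * (3 * t * Polynomial.aeval (3 * t) r) := by
    induction k with
    | zero => exact ⟨1, by simpa using h1⟩
    | succ k ih =>
      obtain ⟨r, hr⟩ := ih
      obtain ⟨s, hs⟩ := exists_sift_mul_aeval ht hF h1 h2 r
      refine ⟨s, ?_⟩
      have := sift_expand_mul (3 ^ k) (3 * t * Polynomial.aeval (3 * t) r)
      rw [map_pow, map_ofNat] at this
      rw [Function.iterate_succ_apply', hr, this, hs]
      ring
  obtain ⟨r, hr⟩ := key
  exact ⟨t * Polynomial.aeval (3 * t) r, by rw [hr]; ring⟩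

end Descent

end CubicPartition

theorem theorem2 (α n : ℕ) :
    CubicPartition.a9 (3 ^ (α + 1) * n + 3 ^ (α + 1) - 1) ≡ 0 [ZMOD 3 ^ (α + 1)] := by
  obtain ⟨g, hg⟩ := CubicPartition.three_pow_dvd_sift_iterate α
  -- The index is n + 1 because the factor `X` in front of `genFun9` shifts exponents by one.
  have h := congrArg (PowerSeries.coeff (n + 1)) hg
  have hpos : 0 < 3 ^ (α + 1) := by positivity
  rw [CubicPartition.coeff_sift_iterate, show 3 ^ (α + 1) * (n + 1) =
    (3 ^ (α + 1) * n + 3 ^ (α + 1) - 1) + 1 by rw [mul_add, mul_one]; lia,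
    PowerSeries.coeff_succ_X_mul] at h
  rw [CubicPartition.a9, h, Int.modEq_zero_iff_dvd]
  have h3 : (3 ^ (α + 1) : PowerSeries ℤ) = PowerSeries.C (3 ^ (α + 1)) := by
    rw [map_pow, map_ofNat]
  rw [h3, PowerSeries.coeff_C_mul]
  exact dvd_mul_right _ _
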